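/- Let $h:[0,\infty)\to\mathbb R$ be continuous (for instance $h=f'$ for a radial potential $f$ of class $C^1$) with $h(r)\le 0$ for all $r>0$, and consider, in dimension $n=4$, the radial equation $$u''(r)+\frac{n-1}{r}u'(r)-(n-2)u(r)^3-\frac{2(n-1)}{r}u(r)^2-\frac{n-1}{r^2}u(r)+(n-4)u(r)u'(r)=\Big[u'(r)+\frac{u(r)}{r}\Big]h(r),\qquad r>0, \tag{1}$$ that is, $u''+\frac3r u'-2u^3-\frac6r u^2-\frac3{r^2}u=\big[u'+\frac ur\big]h$. A solution of (1) on an interval $[0,R)$, $0<R\le\infty$, is a function $u\in C^2[0,R)$ that satisfies (1) for all $0<r<R$; it is global if $R=\infty$, and negative if $u(r)<0$ for all $0<r<R$. Then for every $\alpha<0$ the solution of (1) with $u(0)=0$, $u'(0)=\alpha$ is global and satisfies $$-\frac2r<u(r)<0\qquad\text{for all } r>0.$$ Here "the solution" means that there is a global solution $u$ with these initial data, and that every solution on some $[0,R)$, $0<R\le\infty$, with the same initial data coincides with $u$ on $[0,R)$. In particular, (1) has infinitely many negative global solutions (distinct as functions on $[0,\infty)$). -/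

import Mathlib

/-- `u` solves, at the point `r`, the radial equation in dimension `n`
`u'' + (n-1)/r u' - (n-2) u³ - 2(n-1)/r u² - (n-1)/r² u + (n-4) u u' = (u' + u/r) h`. -/
def RadialODEAt (n : ℕ) (h u : ℝ → ℝ) (r : ℝ) : Prop :=
  deriv (deriv u) r + ((n : ℝ) - 1) / r * deriv u r - ((n : ℝ) - 2) * u r ^ 3
      - 2 * ((n : ℝ) - 1) / r * u r ^ 2 - ((n : ℝ) - 1) / r ^ 2 * u r
      + ((n : ℝ) - 4) * u r * deriv u r
    = (deriv u r + u r / r) * h r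

/-- `u` is a solution of the radial equation on `s`, where `s` is an interval `[0, R)` or `[0, ∞)`:
it is `C²` on `s` (one-sidedly at `0`) and satisfies the equation at every `r > 0` of `s`.
Such points are interior to `s`, so the ordinary derivatives there are the genuine ones.
The values of `u` outside `s` play no role. -/
def IsRadialSolution (n : ℕ) (h : ℝ → ℝ) (s : Set ℝ) (u : ℝ → ℝ) : Prop :=
  ContDiffOn ℝ 2 u s ∧ ∀ r ∈ s, 0 < r → RadialODEAt n h u r

/-- The initial conditions `u(0) = 0`, `u'(0) = α` (right derivative at `0`). -/
def HasInitialData (α : ℝ) (u : ℝ → ℝ) : Prop :=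
  u 0 = 0 ∧ HasDerivWithinAt u α (Set.Ici 0) 0

/-! Put `y = u / r` and `c = y'`. For `a = 4y + rc` and `b = rc` equation (1) becomes `a' = g`,
`(r⁴b)' = r⁴g` with `g = h(2y + rc) + 6ry² + 2r³y³`, so the singularity at `0` is absorbed into
bounded integral operators.

Existence: clamping `y` to `[2α, 0]` makes `g` globally Lipschitz, and a contraction in a weighted
sup norm gives a solution on the whole line (`exists_truncated_profile`).

The clamp is never active: with `w = r²y = ru`, the energy `(r w')² - (w² + 2w)²` vanishes at `0`
and has derivative `2h(r w')² ≤ 0`. Hence `|r w'| ≤ -(w² + 2w)` while `-2 < w < 0`, and integrating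
this inequality keeps `w` strictly between the wells `-2` and `0` (`profile_bounds`).

Uniqueness is a Gronwall argument for the differences of `a` and `b`, where the singular term has a
favourable sign (`IsRadialSolution.eqOn_Ico`). -/

/-! ### Singular Volterra equations. -/

/-- Scaled integrals of a function dominated by `ℓ` times the weight `exp (2 ∫ ℓ)` are dominated by
half of the weight. -/
theorem abs_mul_integral_comp_mul_le {ℓ : ℝ → ℝ} (hℓ : Continuous ℓ) {k f : ℝ → ℝ}
    (hk : Continuous k) (hk1 : ∀ σ ∈ Set.Icc (0 : ℝ) 1, |k σ| ≤ 1) (hf : Continuous f) {N : ℝ}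
    (hN : 0 ≤ N)
    (hfb : ∀ s, |f s| ≤ ℓ |s| * (Real.exp (2 * ∫ t in (0 : ℝ)..|s|, ℓ t) * N)) (r : ℝ) :
    |r * ∫ σ in (0 : ℝ)..1, k σ * f (r * σ)| ≤
      Real.exp (2 * ∫ t in (0 : ℝ)..|r|, ℓ t) * (N / 2) := by
  set φ : ℝ → ℝ := fun x => Real.exp (2 * ∫ t in (0 : ℝ)..x, ℓ t) with hφ
  have hφd : ∀ x, HasDerivAt φ (φ x * (2 * ℓ x)) x := fun x =>
    (((hℓ.integral_hasStrictDerivAt 0 x).hasDerivAt).const_mul 2).exp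
  have hφc : Continuous φ := continuous_iff_continuousAt.2 fun x => (hφd x).continuousAt
  have h1 : |∫ σ in (0 : ℝ)..1, k σ * f (r * σ)| ≤
      ∫ σ in (0 : ℝ)..1, ℓ (|r| * σ) * (φ (|r| * σ) * N) := by
    refine (intervalIntegral.abs_integral_le_integral_abs zero_le_one).trans ?_
    refine intervalIntegral.integral_mono_on zero_le_one ?_ ?_ ?_
    · exact (Continuous.intervalIntegrable (by fun_prop) _ _)
    · exact (Continuous.intervalIntegrable (by fun_prop) _ _)
    · intro σ hσ
      have h2 : |r * σ| = |r| * σ := by rw [abs_mul, abs_of_nonneg hσ.1]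
      have h3 := hfb (r * σ)
      rw [h2] at h3
      rw [abs_mul]
      calc |k σ| * |f (r * σ)| ≤ 1 * |f (r * σ)| :=
            mul_le_mul_of_nonneg_right (hk1 σ hσ) (abs_nonneg _)
        _ ≤ _ := by rw [one_mul]; exact h3
  -- The integrand is an exact derivative: `(φ N / 2)' = ℓ φ N`. The factor `2` in the exponent is
  -- what produces the contraction constant `1 / 2`.
  have h4 : |r| * ∫ σ in (0 : ℝ)..1, ℓ (|r| * σ) * (φ (|r| * σ) * N) =
      (φ |r| - φ 0) * (N / 2) := by
    have h5 := intervalIntegral.mul_integral_comp_mul_left (a := 0) (b := 1)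
      (f := fun s => ℓ s * (φ s * N)) |r|
    rw [h5, mul_zero, mul_one]
    rw [intervalIntegral.integral_eq_sub_of_hasDerivAt (f := fun s => φ s * (N / 2))]
    · ring
    · intro x _
      have h6 : ℓ x * (φ x * N) = φ x * (2 * ℓ x) * (N / 2) := by ring
      rw [h6]
      exact (hφd x).mul_const (N / 2)
    · exact Continuous.intervalIntegrable (by fun_prop) _ _
  have h6 : 0 < φ 0 := Real.exp_pos _
  rw [abs_mul]
  calc _ ≤ |r| * ∫ σ in (0 : ℝ)..1, ℓ (|r| * σ) * (φ (|r| * σ) * N) :=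
        mul_le_mul_of_nonneg_left h1 (abs_nonneg _)
    _ = (φ |r| - φ 0) * (N / 2) := h4
    _ ≤ φ |r| * (N / 2) := by nlinarith

/-- A singular Volterra system with globally Lipschitz nonlinearity has a continuous solution on the
whole line. -/
theorem exists_continuous_volterra_pair {g : ℝ → ℝ × ℝ → ℝ}
    (hg : Continuous fun p : ℝ × (ℝ × ℝ) => g p.1 p.2) (g0 : ∀ s, g s 0 = 0) {ℓ : ℝ → ℝ}
    (hℓ : Continuous ℓ) (hLip : ∀ s x y, |g s x - g s y| ≤ ℓ |s| * ‖x - y‖) (a₀ : ℝ) :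
    ∃ a c : ℝ → ℝ, Continuous a ∧ Continuous c ∧
      (∀ r, a r = a₀ + r * ∫ σ in (0 : ℝ)..1, g (r * σ) (a (r * σ), r * σ * c (r * σ))) ∧
      ∀ r, c r = ∫ σ in (0 : ℝ)..1, σ ^ 4 * g (r * σ) (a (r * σ), r * σ * c (r * σ)) := by
  have hIc : Continuous fun x => ∫ t in (0 : ℝ)..x, ℓ t :=
    intervalIntegral.continuous_primitive (fun a b => hℓ.intervalIntegrable a b) 0
  -- Bielecki weight: the fixed point is sought for `A = (a, r c) / φ`, among bounded continuous
  -- functions.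
  set φ : ℝ → ℝ := fun r => Real.exp (2 * ∫ t in (0 : ℝ)..|r|, ℓ t) with hφ
  have hφc : Continuous φ := by
    have := hIc.comp continuous_abs
    simp only [Function.comp_def] at this
    fun_prop
  have hφ0 : ∀ r, 0 < φ r := fun r => Real.exp_pos _
  have hφi : Continuous fun r => (φ r)⁻¹ := hφc.inv₀ fun r => (hφ0 r).ne'
  let G : (ℝ → ℝ × ℝ) → ℝ → ℝ := fun A s => g s (φ s • A s)
  have hG : ∀ A : ℝ → ℝ × ℝ, Continuous A → Continuous (G A) := fun A hA =>
    hg.comp (continuous_id.prodMk (hφc.smul hA))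
  let I : (ℝ → ℝ) → (ℝ → ℝ × ℝ) → ℝ → ℝ := fun k A r =>
    ∫ σ in (0 : ℝ)..1, k σ * G A (r * σ)
  have hI : ∀ k A, Continuous k → Continuous A → Continuous (I k A) := by
    intro k A hk hA
    have := hG A hA
    exact intervalIntegral.continuous_parametric_intervalIntegral_of_continuous' (by fun_prop) _ _
  let T : (ℝ → ℝ × ℝ) → ℝ → ℝ × ℝ := fun A r =>
    (φ r)⁻¹ • (a₀ + r * I (fun _ => 1) A r, r * I (fun σ => σ ^ 4) A r)
  have hT : ∀ A, Continuous A → Continuous (T A) := by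
    intro A hA
    have h1 := hI (fun _ => 1) A (by fun_prop) hA
    have h2 := hI (fun σ => σ ^ 4) A (by fun_prop) hA
    exact hφi.smul (by fun_prop)
  have hℓn : ∀ t, 0 ≤ t → 0 ≤ ℓ t := by
    intro t ht
    have := (abs_nonneg _).trans (hLip t (1, 0) 0)
    rw [abs_of_nonneg ht] at this
    have h3 : (0 : ℝ) < ‖((1, 0) : ℝ × ℝ) - 0‖ := by simp
    exact nonneg_of_mul_nonneg_left this h3
  have key : ∀ A B : ℝ → ℝ × ℝ, Continuous A → Continuous B → ∀ N : ℝ, 0 ≤ N →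
      (∀ s, ‖A s - B s‖ ≤ N) → ∀ r, ‖T A r - T B r‖ ≤ N / 2 := by
    intro A B hA hB N hN hAB r
    have hkey : ∀ k : ℝ → ℝ, Continuous k → (∀ σ ∈ Set.Icc (0 : ℝ) 1, |k σ| ≤ 1) →
        |(φ r)⁻¹ * (r * I k A r - r * I k B r)| ≤ N / 2 := by
      intro k hk hk1
      have hGA := hG A hA
      have hGB := hG B hB
      have h1 := abs_mul_integral_comp_mul_le hℓ hk hk1 (f := fun s => G A s - G B s)
        (hGA.sub hGB) hN (fun s => by
          refine (hLip s _ _).trans ?_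
          refine mul_le_mul_of_nonneg_left ?_ (hℓn _ (abs_nonneg s))
          rw [← smul_sub, norm_smul, Real.norm_of_nonneg (hφ0 s).le]
          exact mul_le_mul_of_nonneg_left (hAB s) (hφ0 s).le) r
      have h2 : r * I k A r - r * I k B r =
          r * ∫ σ in (0 : ℝ)..1, k σ * (G A (r * σ) - G B (r * σ)) := by
        rw [← mul_sub, ← intervalIntegral.integral_sub
          (Continuous.intervalIntegrable (by fun_prop) _ _)
          (Continuous.intervalIntegrable (by fun_prop) _ _)]
        simp only [mul_sub]
      rw [h2, abs_mul, abs_of_pos (inv_pos.2 (hφ0 r)), inv_mul_le_iff₀ (hφ0 r)]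
      exact h1
    have h1 := hkey (fun _ => 1) continuous_const (by simp)
    have h2 := hkey (fun σ => σ ^ 4) (by fun_prop) (fun σ hσ => by
      rw [abs_of_nonneg (pow_nonneg hσ.1 4)]; exact pow_le_one₀ hσ.1 hσ.2)
    rw [Prod.norm_def]
    refine max_le ?_ ?_
    · rw [Real.norm_eq_abs]
      refine le_of_eq_of_le (congrArg _ ?_) h1
      rw [Prod.fst_sub]
      simp only [T, Prod.smul_fst, smul_eq_mul]
      ring
    · rw [Real.norm_eq_abs]
      refine le_of_eq_of_le (congrArg _ ?_) h2
      rw [Prod.snd_sub]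
      simp only [T, Prod.smul_snd, smul_eq_mul]
      ring
  have hφ1 : ∀ r, 1 ≤ φ r := by
    intro r
    refine Real.one_le_exp ?_
    have := intervalIntegral.integral_nonneg (μ := MeasureTheory.volume) (abs_nonneg r)
      (fun u hu => hℓn u hu.1)
    positivity
  have hT0 : ∀ r, ‖T (fun _ => 0) r‖ ≤ |a₀| := by
    intro r
    have h0 : ∀ s, G (fun _ => 0) s = 0 := fun s => by simp [G, g0]
    have h1 : T (fun _ => 0) r = (φ r)⁻¹ • ((a₀, 0) : ℝ × ℝ) := by
      simp [T, I, h0]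
    have h2 : ‖((a₀, 0) : ℝ × ℝ)‖ = |a₀| := by simp [Prod.norm_def]
    rw [h1, norm_smul, h2, Real.norm_of_nonneg (inv_nonneg.2 (hφ0 r).le)]
    exact mul_le_of_le_one_left (abs_nonneg _) (inv_le_one_of_one_le₀ (hφ1 r))
  let Ψ : BoundedContinuousFunction ℝ (ℝ × ℝ) → BoundedContinuousFunction ℝ (ℝ × ℝ) := fun A =>
    BoundedContinuousFunction.ofNormedAddCommGroup (T A) (hT A A.continuous) (‖A‖ / 2 + |a₀|)
      (fun r => by
        have h1 := key A (fun _ => 0) A.continuous continuous_const ‖A‖ (norm_nonneg _)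
          (fun s => by simpa using A.norm_coe_le_norm s) r
        calc ‖T A r‖ = ‖(T A r - T (fun _ => 0) r) + T (fun _ => 0) r‖ := by rw [sub_add_cancel]
          _ ≤ _ := (norm_add_le _ _).trans (add_le_add h1 (hT0 r)))
  have hΨ : ContractingWith (1 / 2) Ψ := by
    refine ⟨by rw [← NNReal.coe_lt_coe]; norm_num, LipschitzWith.of_dist_le_mul fun A B => ?_⟩
    rw [BoundedContinuousFunction.dist_le (by positivity)]
    intro r
    have h1 := key A B A.continuous B.continuous (dist A B) dist_nonneg (fun s => by
      rw [← dist_eq_norm]; exact BoundedContinuousFunction.dist_coe_le_dist s) r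
    rw [dist_eq_norm]
    refine le_trans h1 (le_of_eq ?_)
    push_cast
    ring
  obtain ⟨A, hA⟩ : ∃ A, Ψ A = A := ⟨_, hΨ.fixedPoint_isFixedPt⟩
  have hA' : ∀ r, φ r • A r = (a₀ + r * I (fun _ => 1) A r, r * I (fun σ => σ ^ 4) A r) := by
    intro r
    have h1 : A r = T A r := by
      conv_lhs => rw [← hA]
      rfl
    rw [h1]
    simp only [T]
    rw [smul_inv_smul₀ (hφ0 r).ne']
  have hGA : ∀ s, G A s = g s ((φ s • A s).1, s * I (fun σ => σ ^ 4) A s) := by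
    intro s
    simp only [G]
    congr 1
    rw [hA' s]
  refine ⟨fun r => (φ r • A r).1, I (fun σ => σ ^ 4) A, (hφc.smul A.continuous).fst,
    hI _ A (by fun_prop) A.continuous, fun r => ?_, fun r => ?_⟩
  · simp only [← hGA]
    rw [hA' r]
    simp [I]
  · simp only [← hGA]
    rfl

theorem hasDerivAt_of_eq_const_add_mul_integral {a F : ℝ → ℝ} {a₀ : ℝ} (hF : Continuous F)
    (ha : ∀ r, a r = a₀ + r * ∫ σ in (0 : ℝ)..1, F (r * σ)) (r : ℝ) :
    HasDerivAt a (F r) r := by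
  have h1 : a = fun r => a₀ + ∫ s in (0 : ℝ)..r, F s := by
    funext r
    rw [ha r, intervalIntegral.mul_integral_comp_mul_left, mul_zero, mul_one]
  rw [h1]
  exact (hF.integral_hasStrictDerivAt 0 r).hasDerivAt.const_add a₀

/-- Rescaling gives `r⁵ c = ∫₀ʳ s⁴ F`; away from `0`, differentiate and divide by `r⁴`. At `0` the
kernel gives `c 0 = F 0 / 5`, so `F 0 - 4 c 0 = c 0`, the limit of the difference quotients of `r
c`. -/
theorem hasDerivAt_mul_of_eq_integral_pow_mul {c F : ℝ → ℝ} (hF : Continuous F)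
    (hc : Continuous c) (hcF : ∀ r, c r = ∫ σ in (0 : ℝ)..1, σ ^ 4 * F (r * σ)) (r : ℝ) :
    HasDerivAt (fun r => r * c r) (F r - 4 * c r) r := by
  rcases eq_or_ne r 0 with rfl | hr
  · have h0 : F 0 - 4 * c 0 = c 0 := by
      have := hcF 0
      simp only [zero_mul, intervalIntegral.integral_mul_const, integral_pow] at this
      norm_num at this
      linarith
    rw [h0, hasDerivAt_iff_tendsto_slope]
    refine (hc.tendsto 0 |>.mono_left nhdsWithin_le_nhds).congr' ?_
    filter_upwards [self_mem_nhdsWithin] with x hx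
    have : x ≠ 0 := hx
    simp [slope_def_field, this]
  · have h1 : ∀ x, x ^ 5 * c x = ∫ s in (0 : ℝ)..x, s ^ 4 * F s := by
      intro x
      have h2 := intervalIntegral.mul_integral_comp_mul_left (a := 0) (b := 1)
        (f := fun s => s ^ 4 * F s) x
      rw [mul_zero, mul_one] at h2
      rw [← h2, hcF x, pow_succ' x 4, mul_assoc, ← intervalIntegral.integral_const_mul]
      congr 2
      funext σ
      ring
    have h3 : HasDerivAt (fun x => x ^ 5 * c x) (r ^ 4 * F r) r := by
      have h4 : (fun x => x ^ 5 * c x) = fun x => ∫ s in (0 : ℝ)..x, s ^ 4 * F s := funext h1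
      rw [h4]
      exact ((continuous_pow 4).mul hF).integral_hasStrictDerivAt 0 r |>.hasDerivAt
    have h5 := h3.div (hasDerivAt_pow 4 r) (pow_ne_zero 4 hr)
    have h6 : (r ^ 4 * F r * r ^ 4 - r ^ 5 * c r * (((4 : ℕ) : ℝ) * r ^ (4 - 1))) / (r ^ 4) ^ 2 =
        F r - 4 * c r := by
      field_simp
      push_cast
      ring
    rw [h6] at h5
    refine h5.congr_of_eventuallyEq ?_
    filter_upwards [isOpen_ne.mem_nhds hr] with x hx
    have hx' : x ≠ 0 := hx
    simp only [Pi.div_apply]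
    field_simp

/-! ### The truncated equation. -/

/-- Restriction of a real number to the interval `[2α, 0]`. -/
noncomputable def clampNeg (α y : ℝ) : ℝ := max (2 * α) (min y 0)

theorem clampNeg_eq_self {α y : ℝ} (h1 : 2 * α ≤ y) (h2 : y ≤ 0) : clampNeg α y = y := by
  rw [clampNeg, min_eq_left h2, max_eq_right h1]

theorem abs_clampNeg_le {α : ℝ} (hα : α < 0) (y : ℝ) : |clampNeg α y| ≤ -(2 * α) :=
  abs_le.2 ⟨by rw [neg_neg]; exact le_max_left _ _,
    (max_le (by linarith) (min_le_right _ _)).trans (by linarith)⟩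

theorem abs_clampNeg_sub_le (α x y : ℝ) : |clampNeg α x - clampNeg α y| ≤ |x - y| := by
  refine (abs_max_sub_max_le_max _ _ _ _).trans ?_
  rw [sub_self, abs_zero, max_eq_right (abs_nonneg _)]
  refine (abs_min_sub_min_le_max _ _ _ _).trans ?_
  rw [sub_self, abs_zero, max_eq_left (abs_nonneg _)]

theorem abs_sq_sub_sq_le {x y M : ℝ} (hx : |x| ≤ M) (hy : |y| ≤ M) :
    |x ^ 2 - y ^ 2| ≤ 2 * M * |x - y| := by
  rw [sq_sub_sq, abs_mul]
  exact mul_le_mul_of_nonneg_right ((abs_add_le _ _).trans (by linarith)) (abs_nonneg _)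

theorem abs_cube_sub_cube_le {x y M : ℝ} (hx : |x| ≤ M) (hy : |y| ≤ M) :
    |x ^ 3 - y ^ 3| ≤ 3 * M ^ 2 * |x - y| := by
  have h1 : x ^ 3 - y ^ 3 = (x ^ 2 + x * y + y ^ 2) * (x - y) := by ring
  rw [h1, abs_mul]
  refine mul_le_mul_of_nonneg_right ?_ (abs_nonneg _)
  have h2 : ∀ a b : ℝ, |a| ≤ M → |b| ≤ M → |a * b| ≤ M * M := fun a b ha hb => by
    rw [abs_mul]; exact mul_le_mul ha hb (abs_nonneg _) ((abs_nonneg _).trans ha)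
  rw [sq x, sq y]
  have h3 := abs_add_three (x * x) (x * y) (y * y)
  have := h2 x x hx hx
  have := h2 x y hx hy
  have := h2 y y hy hy
  linarith

/-- The truncated regularized equation for `y = u / r` with `c = y'`:
it has a solution on the whole line. -/
theorem exists_truncated_profile {h : ℝ → ℝ} (hh : Continuous h) {α : ℝ} (hα : α < 0) :
    ∃ y c : ℝ → ℝ, Continuous y ∧ Continuous c ∧ y 0 = α ∧ (∀ r, HasDerivAt y (c r) r) ∧
      ∀ r, HasDerivAt (fun r => r * c r)
        (h r * (2 * y r + r * c r) + 6 * r * clampNeg α (y r) ^ 2 +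
          2 * r ^ 3 * clampNeg α (y r) ^ 3 - 4 * c r) r := by
  -- Here `x = (4y + rc, rc)`, so `(x.1 + x.2) / 2 = 2y + rc` and `(x.1 - x.2) / 4 = y`.
  let g : ℝ → ℝ × ℝ → ℝ := fun s x => h s * ((x.1 + x.2) / 2) +
    6 * s * clampNeg α ((x.1 - x.2) / 4) ^ 2 + 2 * s ^ 3 * clampNeg α ((x.1 - x.2) / 4) ^ 3
  have hcl : Continuous (clampNeg α) := by
    unfold clampNeg; fun_prop
  have hg : Continuous fun p : ℝ × (ℝ × ℝ) => g p.1 p.2 := by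
    simp only [g]; fun_prop
  have g0 : ∀ s, g s 0 = 0 := by
    intro s
    have h0 : max (2 * α) 0 = 0 := max_eq_right (by linarith)
    simp [g, clampNeg, h0]
  -- Only `ℓ |s|` enters, so both `h t` and `h (-t)` are included. The constants `12` come from the
  -- bound `-2α` on clamped values and their difference being at most `‖x - y‖ / 2`.
  let ℓ : ℝ → ℝ := fun t => |h t| + |h (-t)| + 12 * (-α) * |t| + 12 * α ^ 2 * |t| ^ 3
  have hℓ : Continuous ℓ := by simp only [ℓ]; fun_prop
  have hLip : ∀ s x y, |g s x - g s y| ≤ ℓ |s| * ‖x - y‖ := by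
    intro s x y
    have hx1 : |x.1 - y.1| ≤ ‖x - y‖ := norm_fst_le (x - y)
    have hx2 : |x.2 - y.2| ≤ ‖x - y‖ := norm_snd_le (x - y)
    have hN := norm_nonneg (x - y)
    set N := ‖x - y‖
    set X := clampNeg α ((x.1 - x.2) / 4)
    set Y := clampNeg α ((y.1 - y.2) / 4)
    have hq : |(x.1 + x.2) / 2 - (y.1 + y.2) / 2| ≤ N := by
      rw [abs_le] at *; constructor <;> linarith [hx1.1, hx1.2, hx2.1, hx2.2]
    have hy : |(x.1 - x.2) / 4 - (y.1 - y.2) / 4| ≤ N / 2 := by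
      rw [abs_le] at *; constructor <;> linarith [hx1.1, hx1.2, hx2.1, hx2.2]
    have hXY : |X - Y| ≤ N / 2 := (abs_clampNeg_sub_le _ _ _).trans hy
    have hX : |X| ≤ -(2 * α) := abs_clampNeg_le hα _
    have hY : |Y| ≤ -(2 * α) := abs_clampNeg_le hα _
    have h2 : |X ^ 2 - Y ^ 2| ≤ 2 * (-α) * N :=
      (abs_sq_sub_sq_le hX hY).trans (by nlinarith)
    have h3 : |X ^ 3 - Y ^ 3| ≤ 6 * α ^ 2 * N :=
      (abs_cube_sub_cube_le hX hY).trans (by nlinarith [sq_nonneg α])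
    have hhs : |h s| ≤ |h (|s|)| + |h (-|s|)| := by
      rcases abs_choice s with e | e <;> rw [e]
      · exact le_add_of_nonneg_right (abs_nonneg _)
      · rw [neg_neg]; exact le_add_of_nonneg_left (abs_nonneg _)
    have e : g s x - g s y = h s * ((x.1 + x.2) / 2 - (y.1 + y.2) / 2) +
        6 * s * (X ^ 2 - Y ^ 2) + 2 * s ^ 3 * (X ^ 3 - Y ^ 3) := by
      simp only [g]; ring
    rw [e]
    refine (abs_add_three _ _ _).trans ?_
    simp only [abs_mul, abs_pow, ℓ, abs_abs, Nat.abs_ofNat]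
    have i1 := mul_le_mul hhs hq (abs_nonneg _) (by positivity)
    have i2 := mul_le_mul_of_nonneg_left h2 (show 0 ≤ 6 * |s| by positivity)
    have i3 := mul_le_mul_of_nonneg_left h3 (show 0 ≤ 2 * |s| ^ 3 by positivity)
    linarith
  obtain ⟨a, c, ha, hc, hae, hce⟩ := exists_continuous_volterra_pair hg g0 hℓ hLip (4 * α)
  have hF : Continuous fun s => g s (a s, s * c s) :=
    hg.comp (continuous_id.prodMk (ha.prodMk (continuous_id.mul hc)))
  have hda := hasDerivAt_of_eq_const_add_mul_integral hF hae
  have hdb := hasDerivAt_mul_of_eq_integral_pow_mul hF hc hce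
  refine ⟨fun r => (a r - r * c r) / 4, c, by fun_prop, hc, ?_, fun r => ?_, fun r => ?_⟩
  · have := hae 0
    simp at this ⊢
    linarith
  · have h1 := ((hda r).sub (hdb r)).div_const 4
    have h2 : (g r (a r, r * c r) - (g r (a r, r * c r) - 4 * c r)) / 4 = c r := by ring
    rw [h2] at h1
    exact h1
  · have h1 := hdb r
    have h2 : g r (a r, r * c r) = h r * (2 * ((a r - r * c r) / 4) + r * c r) +
        6 * r * clampNeg α ((a r - r * c r) / 4) ^ 2 +
          2 * r ^ 3 * clampNeg α ((a r - r * c r) / 4) ^ 3 := by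
      simp only [g]; ring
    rw [h2] at h1
    exact h1

/-! ### A priori bounds for the profile. -/

section APriori

variable {h y c : ℝ → ℝ} {α R : ℝ}

/-- The energy estimate: as long as the profile stays in the admissible range, its logarithmic
derivative is controlled by the double-well potential. -/
theorem profile_energy_le (hneg : ∀ r, 0 < r → h r ≤ 0) (hc : Continuous c)
    (hy : ∀ r, HasDerivAt y (c r) r)
    (hrc : ∀ r, HasDerivAt (fun r => r * c r)
        (h r * (2 * y r + r * c r) + 6 * r * clampNeg α (y r) ^ 2 +
          2 * r ^ 3 * clampNeg α (y r) ^ 3 - 4 * c r) r)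
    (hR : ∀ r ∈ Set.Ioo 0 R, 2 * α < y r ∧ y r < 0 ∧ -2 < r ^ 2 * y r) :
    ∀ r ∈ Set.Ioo 0 R, r * y r ^ 2 ≤ c r ∧ r * c r ≤ -4 * y r := by
  -- With `w = r² y`, the first square is `(r w')²`, since `r w' = r² (2y + rc)`.
  let E : ℝ → ℝ := fun r => (r ^ 2 * (2 * y r + r * c r)) ^ 2 -
    ((r ^ 2 * y r) ^ 2 + 2 * (r ^ 2 * y r)) ^ 2
  have hyc : Continuous y := continuous_iff_continuousAt.2 fun r => (hy r).continuousAt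
  have hEc : Continuous E := by simp only [E]; fun_prop
  have hE : ∀ r ∈ Set.Ioo 0 R,
      HasDerivAt E (2 * h r * (r ^ 2 * (2 * y r + r * c r)) ^ 2) r := by
    intro r hr
    obtain ⟨b1, b2, -⟩ := hR r hr
    have h1 := hrc r
    rw [clampNeg_eq_self b1.le b2.le] at h1
    have hw := (hasDerivAt_pow 2 r).mul (hy r)
    have hp := (hasDerivAt_pow 2 r).mul (((hy r).const_mul 2).add h1)
    have hd := (hp.pow 2).sub (((hw.pow 2).add (hw.const_mul 2)).pow 2)
    refine hd.congr_deriv ?_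
    simp only [Pi.mul_apply, Pi.add_apply, Pi.pow_apply]
    push_cast
    ring
  have hanti : AntitoneOn E (Set.Icc 0 R) := by
    refine antitoneOn_of_deriv_nonpos (convex_Icc _ _) hEc.continuousOn ?_ ?_
    · rw [interior_Icc]
      exact fun r hr => (hE r hr).differentiableAt.differentiableWithinAt
    · rw [interior_Icc]
      intro r hr
      rw [(hE r hr).deriv]
      have := hneg r hr.1
      nlinarith [sq_nonneg (r ^ 2 * (2 * y r + r * c r))]
  intro r hr
  obtain ⟨-, b2, b3⟩ := hR r hr
  have h0 : 0 < r := hr.1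
  have hE0 : E r ≤ 0 := by
    have := hanti ⟨le_rfl, (hr.1.trans hr.2).le⟩ ⟨hr.1.le, hr.2.le⟩ hr.1.le
    simpa [E] using this
  have hsq : (r ^ 2 * (2 * y r + r * c r)) ^ 2 ≤
      ((r ^ 2 * y r) ^ 2 + 2 * (r ^ 2 * y r)) ^ 2 := by
    simp only [E] at hE0; linarith
  have hwneg : (r ^ 2 * y r) ^ 2 + 2 * (r ^ 2 * y r) ≤ 0 := by
    have : r ^ 2 * y r < 0 := mul_neg_of_pos_of_neg (by positivity) b2
    nlinarith
  have habs := sq_le_sq.1 hsq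
  rw [abs_of_nonpos hwneg, abs_le] at habs
  have hr2 : 0 < r ^ 2 := by positivity
  constructor
  · have h1 : r ^ 3 * (r * y r ^ 2) ≤ r ^ 3 * c r := by nlinarith [habs.1]
    exact le_of_mul_le_mul_left h1 (by positivity)
  · have h1 : r ^ 2 * (r * c r) ≤ r ^ 2 * (-4 * y r) := by
      nlinarith [habs.2, sq_nonneg (r ^ 2 * y r)]
    exact le_of_mul_le_mul_left h1 hr2

/-- The energy estimates integrate to three monotonicities: `y` increases, hence `y R ≥ α > 2α`; `r⁴
y` decreases, hence `y R < 0`; `1 / y + r² / 2` decreases from `1 / α < 0`, hence `R² y R > -2`.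
Strictness survives at the endpoint. -/
theorem profile_bounds_endpoint (hα : α < 0) (hR0 : 0 < R) (hy0 : y 0 = α)
    (hy : ∀ r, HasDerivAt y (c r) r) (hlt : ∀ r ∈ Set.Ioo 0 R, y r < 0)
    (hE : ∀ r ∈ Set.Ioo 0 R, r * y r ^ 2 ≤ c r ∧ r * c r ≤ -4 * y r) :
    2 * α < y R ∧ y R < 0 ∧ -2 < R ^ 2 * y R := by
  have hyc : Continuous y := continuous_iff_continuousAt.2 fun r => (hy r).continuousAt
  have hmono : MonotoneOn y (Set.Icc 0 R) := by
    refine monotoneOn_of_deriv_nonneg (convex_Icc _ _) hyc.continuousOn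
      (fun r _ => (hy r).differentiableAt.differentiableWithinAt) ?_
    rw [interior_Icc]
    intro r hr
    rw [(hy r).deriv]
    exact le_trans (mul_nonneg hr.1.le (sq_nonneg _)) (hE r hr).1
  have hd4 : ∀ r, HasDerivAt (fun r => r ^ 4 * y r) (4 * r ^ 3 * y r + r ^ 4 * c r) r := by
    intro r
    refine ((hasDerivAt_pow 4 r).mul (hy r)).congr_deriv ?_
    push_cast
    ring
  have hanti : AntitoneOn (fun r => r ^ 4 * y r) (Set.Icc 0 R) := by
    refine antitoneOn_of_deriv_nonpos (convex_Icc _ _) (by fun_prop)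
      (fun r _ => (hd4 r).differentiableAt.differentiableWithinAt) ?_
    rw [interior_Icc]
    intro r hr
    rw [(hd4 r).deriv]
    have h1 : 0 < r ^ 3 := pow_pos hr.1 3
    nlinarith [(hE r hr).2]
  have hhalf : R / 2 ∈ Set.Ioo 0 R := ⟨by linarith, by linarith⟩
  have hneg : y R < 0 := by
    have h1 : R ^ 4 * y R ≤ (R / 2) ^ 4 * y (R / 2) :=
      hanti ⟨hhalf.1.le, hhalf.2.le⟩ ⟨hR0.le, le_rfl⟩ hhalf.2.le
    have h2 : (R / 2) ^ 4 * y (R / 2) < 0 :=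
      mul_neg_of_pos_of_neg (pow_pos hhalf.1 4) (hlt _ hhalf)
    exact neg_of_mul_neg_right (h1.trans_lt h2) (by positivity)
  have hne : ∀ r ∈ Set.Icc 0 R, y r ≠ 0 := by
    intro r hr
    exact ((hmono hr ⟨hR0.le, le_rfl⟩ hr.2).trans_lt hneg).ne
  have hdi : ∀ r ∈ Set.Icc 0 R,
      HasDerivAt (fun r => (y r)⁻¹ + r ^ 2 / 2) (-c r / y r ^ 2 + r) r := by
    intro r hr
    refine (((hy r).fun_inv (hne r hr)).add ((hasDerivAt_pow 2 r).div_const 2)).congr_deriv ?_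
    push_cast
    ring
  have hanti' : AntitoneOn (fun r => (y r)⁻¹ + r ^ 2 / 2) (Set.Icc 0 R) := by
    refine antitoneOn_of_deriv_nonpos (convex_Icc _ _)
      (fun r hr => (hdi r hr).continuousAt.continuousWithinAt) ?_ ?_
    · rw [interior_Icc]
      exact fun r hr =>
        (hdi r (Set.Ioo_subset_Icc_self hr)).differentiableAt.differentiableWithinAt
    · rw [interior_Icc]
      intro r hr
      rw [(hdi r (Set.Ioo_subset_Icc_self hr)).deriv, neg_div]
      have h1 : 0 < y r ^ 2 := by
        have := hne r (Set.Ioo_subset_Icc_self hr)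
        positivity
      have h2 : r ≤ c r / y r ^ 2 := by
        rw [le_div_iff₀ h1]; exact (hE r hr).1
      linarith
  have hlow : α ≤ y R := by
    rw [← hy0]; exact hmono ⟨le_rfl, hR0.le⟩ ⟨hR0.le, le_rfl⟩ hR0.le
  refine ⟨by linarith, hneg, ?_⟩
  have h1 : (y R)⁻¹ + R ^ 2 / 2 ≤ (y 0)⁻¹ + 0 ^ 2 / 2 :=
    hanti' ⟨le_rfl, hR0.le⟩ ⟨hR0.le, le_rfl⟩ hR0.le
  have h2 : (y 0)⁻¹ < 0 := by rw [hy0]; exact inv_lt_zero.2 hα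
  have h3 : R ^ 2 / 2 < -(y R)⁻¹ := by linarith
  have h4 : y R * -(y R)⁻¹ = -1 := by rw [mul_neg, mul_inv_cancel₀ hneg.ne]
  nlinarith [mul_lt_mul_of_neg_left h3 hneg]

/-- The profile of the truncated equation never leaves the admissible range. -/
theorem profile_bounds (hα : α < 0) (hneg : ∀ r, 0 < r → h r ≤ 0) (hc : Continuous c)
    (hy0 : y 0 = α) (hy : ∀ r, HasDerivAt y (c r) r)
    (hrc : ∀ r, HasDerivAt (fun r => r * c r)
        (h r * (2 * y r + r * c r) + 6 * r * clampNeg α (y r) ^ 2 +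
          2 * r ^ 3 * clampNeg α (y r) ^ 3 - 4 * c r) r) {r : ℝ} (hr : 0 ≤ r) :
    2 * α < y r ∧ y r < 0 ∧ -2 < r ^ 2 * y r := by
  have hyc : Continuous y := continuous_iff_continuousAt.2 fun r => (hy r).continuousAt
  -- Closed set of bad radii; its infimum would be a first exit time, at which the endpoint bounds
  -- still hold strictly.
  let B : Set ℝ := {r | 0 ≤ r ∧ (y r ≤ 2 * α ∨ 0 ≤ y r ∨ r ^ 2 * y r ≤ -2)}
  have hBc : IsClosed B := by
    refine (isClosed_le continuous_const continuous_id).inter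
      ((isClosed_le hyc continuous_const).union ((isClosed_le continuous_const hyc).union
        (isClosed_le ((continuous_pow 2).mul hyc) continuous_const)))
  have hgood : ∀ s, 0 ≤ s → s ∉ B → 2 * α < y s ∧ y s < 0 ∧ -2 < s ^ 2 * y s := by
    intro s hs hsB
    simp only [B, Set.mem_ofPred_eq, not_and, not_or, not_le] at hsB
    exact hsB hs
  refine hgood r hr fun hrB => ?_
  have hbdd : BddBelow B := ⟨0, fun s hs => hs.1⟩
  have hmem : sInf B ∈ B := hBc.csInf_mem ⟨r, hrB⟩ hbdd
  have hpos : 0 < sInf B := by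
    refine lt_of_le_of_ne hmem.1 fun h0 => ?_
    rw [← h0] at hmem
    have h1 := hmem.2
    rw [hy0] at h1
    rcases h1 with h1 | h1 | h1
    · linarith
    · linarith
    · norm_num at h1
  have hin : ∀ s ∈ Set.Ioo 0 (sInf B), 2 * α < y s ∧ y s < 0 ∧ -2 < s ^ 2 * y s :=
    fun s hs => hgood s hs.1.le fun hsB => not_le.2 hs.2 (csInf_le hbdd hsB)
  obtain ⟨b1, b2, b3⟩ := profile_bounds_endpoint hα hpos hy0 hy (fun s hs => (hin s hs).2.1)
    (profile_energy_le hneg hc hy hrc hin)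
  rcases hmem.2 with h1 | h1 | h1 <;> linarith

end APriori

/-! ### Existence for the original equation. -/

theorem exists_radialSolution {h : ℝ → ℝ} (h_cont : ContinuousOn h (Set.Ici 0))
    (h_nonpos : ∀ r : ℝ, 0 < r → h r ≤ 0) {α : ℝ} (hα : α < 0) :
    ∃ u : ℝ → ℝ, IsRadialSolution 4 h (Set.Ici 0) u ∧ HasInitialData α u ∧
      ∀ r : ℝ, 0 < r → -2 / r < u r ∧ u r < 0 := by
  -- Even extension of `h`, since continuity is only given on `[0, ∞)`.
  have hh : Continuous fun r => h |r| := h_cont.comp_continuous continuous_abs fun r => abs_nonneg r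
  obtain ⟨y, c, hyc, hc, hy0, hy, hrc⟩ := exists_truncated_profile hh hα
  have hb := fun r (hr : 0 ≤ r) => profile_bounds (h := fun r => h |r|) hα
    (fun r hr => by rw [abs_of_pos hr]; exact h_nonpos r hr) hc hy0 hy hrc hr
  have hu : ∀ r, HasDerivAt (fun r => r * y r) (y r + r * c r) r := fun r =>
    ((hasDerivAt_id r).mul (hy r)).congr_deriv (by simp)
  have hdu : deriv (fun r => r * y r) = fun r => y r + r * c r := funext fun r => (hu r).deriv
  have hu2 := fun r => (hy r).add (hrc r)
  have hddu : deriv (fun r => y r + r * c r) = fun r => c r + (h |r| * (2 * y r + r * c r) +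
      6 * r * clampNeg α (y r) ^ 2 + 2 * r ^ 3 * clampNeg α (y r) ^ 3 - 4 * c r) :=
    funext fun r => (hu2 r).deriv
  have hcl : Continuous (clampNeg α) := by
    unfold clampNeg; fun_prop
  have hC2 : ContDiff ℝ 2 fun r => r * y r := by
    rw [show (2 : WithTop ℕ∞) = 1 + 1 from (one_add_one_eq_two).symm, contDiff_succ_iff_deriv]
    refine ⟨fun r => (hu r).differentiableAt, by simp, ?_⟩
    rw [hdu, contDiff_one_iff_deriv]
    refine ⟨fun r => (hu2 r).differentiableAt, ?_⟩
    rw [hddu]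
    refine hc.add ((((hh.mul ?_).add ?_).add ?_).sub ?_) <;> fun_prop
  refine ⟨fun r => r * y r, ⟨hC2.contDiffOn, fun r _ hr => ?_⟩, ⟨by simp, ?_⟩, fun r hr => ?_⟩
  · obtain ⟨b1, b2, -⟩ := hb r hr.le
    rw [RadialODEAt, hdu, hddu]
    simp only [clampNeg_eq_self b1.le b2.le, abs_of_pos hr]
    field_simp
    push_cast
    ring
  · have h1 := hu 0
    rw [zero_mul, add_zero, hy0] at h1
    exact h1.hasDerivWithinAt
  · obtain ⟨-, b2, b3⟩ := hb r hr.le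
    refine ⟨?_, mul_neg_of_pos_of_neg hr b2⟩
    rw [div_lt_iff₀ hr]
    nlinarith

/-! ### Uniqueness. -/

section Uniqueness

variable {h w w₁ w₂ : ℝ → ℝ} {α R : ℝ}

theorem IsRadialSolution.hasDerivAt (hw : IsRadialSolution 4 h (Set.Ico 0 R) w) {r : ℝ}
    (hr : r ∈ Set.Ioo 0 R) :
    HasDerivAt w (deriv w r) r ∧ HasDerivAt (deriv w) (deriv (deriv w) r) r := by
  have h1 : ContDiffAt ℝ 2 w r := hw.1.contDiffAt (Ico_mem_nhds hr.1 hr.2)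
  have h2 : ContDiffAt ℝ 1 (deriv w) r :=
    (h1.fderiv_right (m := 1) one_add_one_eq_two.le).clm_apply contDiffAt_const
  exact ⟨(h1.differentiableAt (by norm_num)).hasDerivAt,
    (h2.differentiableAt (by norm_num)).hasDerivAt⟩

theorem HasInitialData.tendsto_div (hα : HasInitialData α w) :
    Filter.Tendsto (fun r => w r / r) (nhdsWithin 0 (Set.Ioi 0)) (nhds α) := by
  have h1 := hα.2.Ioi_of_Ici
  rw [hasDerivWithinAt_iff_tendsto_slope' (by simp)] at h1
  refine h1.congr fun r => ?_
  rw [slope_def_field, hα.1, sub_zero, sub_zero]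

theorem IsRadialSolution.tendsto_deriv (hR : 0 < R) (hw : IsRadialSolution 4 h (Set.Ico 0 R) w)
    (hα : HasInitialData α w) :
    Filter.Tendsto (deriv w) (nhdsWithin 0 (Set.Ioi 0)) (nhds α) := by
  have hmem : (0 : ℝ) ∈ Set.Ico 0 R := ⟨le_rfl, hR⟩
  have h1 := (hw.1.continuousOn_derivWithin (uniqueDiffOn_Ico 0 R) (by norm_num)) 0 hmem
  have h2 : derivWithin w (Set.Ico 0 R) 0 = α :=
    (hα.2.mono Set.Ico_subset_Ici_self).derivWithin (uniqueDiffOn_Ico 0 R 0 hmem)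
  rw [ContinuousWithinAt, h2] at h1
  have h3 : nhdsWithin (0 : ℝ) (Set.Ioo 0 R) = nhdsWithin 0 (Set.Ioi 0) :=
    nhdsWithin_Ioo_eq_nhdsGT hR
  rw [← h3]
  refine (h1.mono_left (nhdsWithin_mono _ Set.Ioo_subset_Ico_self)).congr' ?_
  filter_upwards [self_mem_nhdsWithin] with r hr
  exact derivWithin_of_mem_nhds (Ico_mem_nhds hr.1 hr.2)

theorem IsRadialSolution.exists_abs_div_le (hw : IsRadialSolution 4 h (Set.Ico 0 R) w)
    (h0 : w 0 = 0) {r₀ : ℝ} (hr₀ : r₀ ∈ Set.Ioo 0 R) :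
    ∃ M, ∀ r ∈ Set.Ioc 0 r₀, |w r / r| ≤ M := by
  have h1 : ContDiffOn ℝ 2 w (Set.Icc 0 r₀) :=
    hw.1.mono fun x hx => ⟨hx.1, hx.2.trans_lt hr₀.2⟩
  have h2 := h1.continuousOn_derivWithin (uniqueDiffOn_Icc hr₀.1) (by norm_num)
  obtain ⟨M, hM⟩ := isCompact_Icc.exists_bound_of_continuousOn h2
  refine ⟨M, fun r hr => ?_⟩
  have h3 := (convex_Icc 0 r₀).norm_image_sub_le_of_norm_derivWithin_le
    (h1.differentiableOn (by norm_num)) hM ⟨le_rfl, hr₀.1.le⟩ (Set.Ioc_subset_Icc_self hr)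
  rw [h0, sub_zero, sub_zero, Real.norm_eq_abs, Real.norm_eq_abs] at h3
  rw [abs_div, div_le_iff₀ (abs_pos.2 hr.1.ne')]
  exact h3

/-- The linear equation satisfied by the difference of two solutions. -/
theorem RadialODEAt.sub_eq {r : ℝ} (hr : 0 < r) (h₁ : RadialODEAt 4 h w₁ r)
    (h₂ : RadialODEAt 4 h w₂ r) :
    deriv (deriv w₁) r - deriv (deriv w₂) r + 3 * (deriv w₁ r - deriv w₂ r) / r -
        3 * (w₁ r - w₂ r) / r ^ 2 =
      h r * (deriv w₁ r - deriv w₂ r + (w₁ r - w₂ r) / r) +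
        6 * r * ((w₁ r / r) ^ 2 - (w₂ r / r) ^ 2) +
        2 * r ^ 3 * ((w₁ r / r) ^ 3 - (w₂ r / r) ^ 3) := by
  unfold RadialODEAt at h₁ h₂
  have e1 : r ^ 3 * (w₁ r / r) ^ 3 = w₁ r ^ 3 := by field_simp
  have e2 : r ^ 3 * (w₂ r / r) ^ 3 = w₂ r ^ 3 := by field_simp
  have e3 : r * (w₁ r / r) ^ 2 = w₁ r ^ 2 / r := by field_simp
  have e4 : r * (w₂ r / r) ^ 2 = w₂ r ^ 2 / r := by field_simp
  push_cast at h₁ h₂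
  linear_combination h₁ - h₂ + 2 * e2 - 2 * e1 + 6 * e4 - 6 * e3

/-- Both `d` and `d' + d` are combinations of `d' + 3d` and `d' - d`, the quantities used in the
Gronwall argument. -/
theorem abs_radial_difference_le {r r₁ H M H' d d' y₁ y₂ : ℝ} (hr : 0 < r) (hr₁ : r ≤ r₁)
    (hH : |H'| ≤ H) (h1 : |y₁| ≤ M) (h2 : |y₂| ≤ M) (hd : y₁ - y₂ = d) :
    |H' * (d' + d) + 6 * r * (y₁ ^ 2 - y₂ ^ 2) + 2 * r ^ 3 * (y₁ ^ 3 - y₂ ^ 3)| ≤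
      (H + 3 * r₁ * M + 2 * r₁ ^ 3 * M ^ 2) * (|d' + 3 * d| + |d' - d|) := by
  set S := |d' + 3 * d| + |d' - d| with hS
  have hS0 : 0 ≤ S := by positivity
  have hM : 0 ≤ M := (abs_nonneg _).trans h1
  have hH0 : 0 ≤ H := (abs_nonneg _).trans hH
  have hdS : |d| ≤ S / 4 := by
    have h3 := abs_sub (d' + 3 * d) (d' - d)
    rw [show d' + 3 * d - (d' - d) = 4 * d by ring, abs_mul, Nat.abs_ofNat] at h3
    linarith
  have hqS : |d' + d| ≤ S := by
    have h3 := abs_add_le (d' + 3 * d) (d' - d)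
    rw [show d' + 3 * d + (d' - d) = 2 * (d' + d) by ring, abs_mul, Nat.abs_ofNat] at h3
    linarith
  have i1 : |H' * (d' + d)| ≤ H * S := by
    rw [abs_mul]; exact mul_le_mul hH hqS (abs_nonneg _) hH0
  have i2 : |6 * r * (y₁ ^ 2 - y₂ ^ 2)| ≤ 3 * r₁ * M * S := by
    rw [abs_mul, abs_of_pos (show 0 < 6 * r by positivity)]
    have h3 := abs_sq_sub_sq_le h1 h2
    rw [hd] at h3
    have hr₁0 : 0 < r₁ := hr.trans_le hr₁
    calc 6 * r * |y₁ ^ 2 - y₂ ^ 2| ≤ 6 * r₁ * (2 * M * (S / 4)) := by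
          gcongr; exact h3.trans (by gcongr)
      _ = 3 * r₁ * M * S := by ring
  have i3 : |2 * r ^ 3 * (y₁ ^ 3 - y₂ ^ 3)| ≤ 2 * r₁ ^ 3 * M ^ 2 * S := by
    rw [abs_mul, abs_of_pos (show 0 < 2 * r ^ 3 by positivity)]
    have h3 := abs_cube_sub_cube_le h1 h2
    rw [hd] at h3
    have hr₁0 : 0 < r₁ := hr.trans_le hr₁
    calc 2 * r ^ 3 * |y₁ ^ 3 - y₂ ^ 3| ≤ 2 * r₁ ^ 3 * (3 * M ^ 2 * (S / 4)) := by
          gcongr; exact h3.trans (by gcongr)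
      _ ≤ 2 * r₁ ^ 3 * M ^ 2 * S := by
          have : 0 ≤ r₁ ^ 3 * M ^ 2 * S := by positivity
          nlinarith
  have := abs_add_three (H' * (d' + d)) (6 * r * (y₁ ^ 2 - y₂ ^ 2)) (2 * r ^ 3 * (y₁ ^ 3 - y₂ ^ 3))
  linarith

theorem IsRadialSolution.eqOn_Ico (h_cont : ContinuousOn h (Set.Ici 0))
    (hw₁ : IsRadialSolution 4 h (Set.Ico 0 R) w₁) (hα₁ : HasInitialData α w₁)
    (hw₂ : IsRadialSolution 4 h (Set.Ico 0 R) w₂) (hα₂ : HasInitialData α w₂) :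
    Set.EqOn w₁ w₂ (Set.Ico 0 R) := by
  intro r₁ hr₁
  rcases hr₁.1.eq_or_lt with rfl | hpos
  · rw [hα₁.1, hα₂.1]
  have hr₁' : r₁ ∈ Set.Ioo 0 R := ⟨hpos, hr₁.2⟩
  obtain ⟨M₁, hM₁⟩ := hw₁.exists_abs_div_le hα₁.1 hr₁'
  obtain ⟨M₂, hM₂⟩ := hw₂.exists_abs_div_le hα₂.1 hr₁'
  obtain ⟨H, hH⟩ := isCompact_Icc.exists_bound_of_continuousOn
    (h_cont.mono (Set.Icc_subset_Ici_self : Set.Icc 0 r₁ ⊆ Set.Ici 0))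
  set M := max M₁ M₂
  set K := H + 3 * r₁ * M + 2 * r₁ ^ 3 * M ^ 2 with hK
  have hM0 : 0 ≤ M := ((abs_nonneg _).trans (hM₁ r₁ ⟨hpos, le_rfl⟩)).trans (le_max_left _ _)
  have hH0 : 0 ≤ H := (norm_nonneg _).trans (hH r₁ ⟨hpos.le, le_rfl⟩)
  have hK0 : 0 ≤ K := by positivity
  -- `A` and `B` are the differences of `4y + ry'` and `ry'`. They satisfy `A' = g` and `B' = g -
  -- 4B/r` with `|g| ≤ K(|A| + |B|)`.
  let A : ℝ → ℝ := fun r => deriv w₁ r - deriv w₂ r + 3 * (w₁ r / r - w₂ r / r)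
  let B : ℝ → ℝ := fun r => deriv w₁ r - deriv w₂ r - (w₁ r / r - w₂ r / r)
  -- `(A² + B²)' ≤ 4K(A² + B²) - 8B²/r`, so `D` decreases. It tends to `0` at `0⁺` because both
  -- solutions have slope `α` there.
  let D : ℝ → ℝ := fun r => Real.exp (-(4 * K) * r) * (A r ^ 2 + B r ^ 2)
  have hD : ∀ r ∈ Set.Ioc 0 r₁, ∃ D', HasDerivAt D D' r ∧ D' ≤ 0 := by
    intro r hr
    have hrR : r ∈ Set.Ioo 0 R := ⟨hr.1, hr.2.trans_lt hr₁.2⟩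
    have hr0 : r ≠ 0 := hr.1.ne'
    obtain ⟨d₁, dd₁⟩ := hw₁.hasDerivAt hrR
    obtain ⟨d₂, dd₂⟩ := hw₂.hasDerivAt hrR
    have hode := RadialODEAt.sub_eq hr.1 (hw₁.2 r ⟨hrR.1.le, hrR.2⟩ hr.1)
      (hw₂.2 r ⟨hrR.1.le, hrR.2⟩ hr.1)
    set g := h r * (deriv w₁ r - deriv w₂ r + (w₁ r - w₂ r) / r) +
        6 * r * ((w₁ r / r) ^ 2 - (w₂ r / r) ^ 2) +
        2 * r ^ 3 * ((w₁ r / r) ^ 3 - (w₂ r / r) ^ 3) with hg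
    have hq := (d₁.div (hasDerivAt_id r) hr0).sub (d₂.div (hasDerivAt_id r) hr0)
    have hA : HasDerivAt A g r := by
      refine ((dd₁.sub dd₂).add (hq.const_mul 3)).congr_deriv ?_
      rw [← hode]
      simp only [id]
      field_simp
      ring
    have hB : HasDerivAt B (g - 4 * B r / r) r := by
      refine ((dd₁.sub dd₂).sub hq).congr_deriv ?_
      rw [← hode]
      simp only [id, B]
      field_simp
      ring
    have hE : HasDerivAt (fun r => Real.exp (-(4 * K) * r))
        (Real.exp (-(4 * K) * r) * -(4 * K)) r := by
      simpa using ((hasDerivAt_id r).const_mul (-(4 * K))).exp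
    refine ⟨_, hE.mul ((hA.pow 2).add (hB.pow 2)), ?_⟩
    have hgb : |g| ≤ K * (|A r| + |B r|) := by
      have := abs_radial_difference_le (d := w₁ r / r - w₂ r / r)
        (d' := deriv w₁ r - deriv w₂ r) hr.1 hr.2
        (hH r (Set.Ioc_subset_Icc_self hr)) ((hM₁ r hr).trans (le_max_left M₁ M₂))
        ((hM₂ r hr).trans (le_max_right M₁ M₂)) rfl
      rw [hg, sub_div]
      exact this
    have hsum : (A r + B r) * g ≤ 2 * K * (A r ^ 2 + B r ^ 2) := by
      have h1 : (A r + B r) * g ≤ (|A r| + |B r|) * (K * (|A r| + |B r|)) := by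
        refine (le_abs_self _).trans ?_
        rw [abs_mul]
        exact mul_le_mul (abs_add_le _ _) hgb (abs_nonneg _) (by positivity)
      have h2 : (|A r| + |B r|) ^ 2 ≤ 2 * (A r ^ 2 + B r ^ 2) := by
        rw [← sq_abs (A r), ← sq_abs (B r)]
        exact add_sq_le
      nlinarith
    have hBr : 0 ≤ B r ^ 2 / r := div_nonneg (sq_nonneg _) hr.1.le
    have hexp := Real.exp_pos (-(4 * K) * r)
    have hfin : 2 * A r * g + 2 * B r * (g - 4 * B r / r) - 4 * K * (A r ^ 2 + B r ^ 2) ≤ 0 := by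
      have : 2 * B r * (g - 4 * B r / r) = 2 * B r * g - 8 * (B r ^ 2 / r) := by ring
      rw [this]
      linarith
    have := mul_nonpos_of_nonneg_of_nonpos hexp.le hfin
    push_cast
    linarith
  have hanti : AntitoneOn D (Set.Ioc 0 r₁) := by
    refine antitoneOn_of_deriv_nonpos (convex_Ioc _ _) (fun r hr => ?_) (fun r hr => ?_)
      (fun r hr => ?_)
    · obtain ⟨D', h1, -⟩ := hD r hr
      exact h1.continuousAt.continuousWithinAt
    · obtain ⟨D', h1, -⟩ := hD r (interior_subset hr)
      exact h1.differentiableAt.differentiableWithinAt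
    · obtain ⟨D', h1, h2⟩ := hD r (interior_subset hr)
      rwa [h1.deriv]
  have hR : 0 < R := hpos.trans hr₁.2
  have hlim : Filter.Tendsto D (nhdsWithin 0 (Set.Ioi 0)) (nhds 0) := by
    have t1 := (hw₁.tendsto_deriv hR hα₁).sub (hw₂.tendsto_deriv hR hα₂)
    have t2 := hα₁.tendsto_div.sub hα₂.tendsto_div
    have t3 : Filter.Tendsto (fun r => Real.exp (-(4 * K) * r)) (nhdsWithin 0 (Set.Ioi 0))
        (nhds (Real.exp (-(4 * K) * 0))) :=
      (Continuous.tendsto (by fun_prop) 0).mono_left nhdsWithin_le_nhds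
    have t4 := t3.mul (((t1.add (t2.const_mul 3)).pow 2).add ((t1.sub t2).pow 2))
    simpa [D, A, B] using t4
  have hle : D r₁ ≤ 0 := by
    refine ge_of_tendsto hlim ?_
    filter_upwards [Ioc_mem_nhdsGT hpos] with r hr
    exact hanti hr ⟨hpos, le_rfl⟩ hr.2
  have hsq : A r₁ ^ 2 + B r₁ ^ 2 ≤ 0 := by
    by_contra! hcon
    exact absurd hle (not_le.2 (mul_pos (Real.exp_pos _) hcon))
  have hA0 : A r₁ = 0 := by nlinarith [sq_nonneg (A r₁), sq_nonneg (B r₁)]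
  have hB0 : B r₁ = 0 := by nlinarith [sq_nonneg (A r₁), sq_nonneg (B r₁)]
  have heq : w₁ r₁ / r₁ = w₂ r₁ / r₁ := by
    simp only [A, B] at hA0 hB0
    linarith
  exact (div_left_inj' hpos.ne').1 heq

end Uniqueness

/-! ### Conclusion. -/

theorem mainTheorem2 (h : ℝ → ℝ) (h_cont : ContinuousOn h (Set.Ici 0))
    (h_nonpos : ∀ r : ℝ, 0 < r → h r ≤ 0) :
    (∀ α : ℝ, α < 0 →
      ∃ u : ℝ → ℝ, IsRadialSolution 4 h (Set.Ici 0) u ∧ HasInitialData α u ∧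
        (∀ r : ℝ, 0 < r → -2 / r < u r ∧ u r < 0) ∧
        (∀ w : ℝ → ℝ, IsRadialSolution 4 h (Set.Ici 0) w → HasInitialData α w →
          Set.EqOn w u (Set.Ici 0)) ∧
        (∀ R : ℝ, 0 < R → ∀ w : ℝ → ℝ, IsRadialSolution 4 h (Set.Ico 0 R) w →
          HasInitialData α w → Set.EqOn w u (Set.Ico 0 R))) ∧
    (Set.domRestrict (Set.Ici (0 : ℝ)) ''
      {u : ℝ → ℝ | IsRadialSolution 4 h (Set.Ici 0) u ∧ ∀ r : ℝ, 0 < r → u r < 0}).Infinite := by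
  have hres : ∀ (u : ℝ → ℝ) (R : ℝ), IsRadialSolution 4 h (Set.Ici 0) u →
      IsRadialSolution 4 h (Set.Ico 0 R) u := fun u R hu =>
    ⟨hu.1.mono Set.Ico_subset_Ici_self, fun r hr => hu.2 r hr.1⟩
  refine ⟨fun α hα => ?_, ?_⟩
  · obtain ⟨u, hu, hαu, hb⟩ := exists_radialSolution h_cont h_nonpos hα
    refine ⟨u, hu, hαu, hb, fun w hw hαw r hr => ?_, fun R _ w hw hαw => ?_⟩
    · exact (hres w (r + 1) hw).eqOn_Ico h_cont hαw (hres u (r + 1) hu) hαu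
        ⟨hr, lt_add_one r⟩
    · exact hw.eqOn_Ico h_cont hαw (hres u R hu) hαu
  -- The slopes `α = -(n + 1)` give solutions told apart by their right derivative at `0`.
  · have hneg : ∀ n : ℕ, -((n : ℝ) + 1) < 0 := fun n => by
      have : (0 : ℝ) ≤ n := n.cast_nonneg
      linarith
    choose u hu hαu hb using fun n : ℕ => exists_radialSolution h_cont h_nonpos (hneg n)
    refine Set.infinite_of_injective_forall_mem (f := fun n => Set.domRestrict (Set.Ici 0) (u n))
      (fun m n hmn => ?_) fun n => ⟨u n, ⟨hu n, fun r hr => (hb n r hr).2⟩, rfl⟩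
    have heq : Set.EqOn (u m) (u n) (Set.Ici 0) := fun r hr => congrFun hmn ⟨r, hr⟩
    have h1 := (hαu n).2.congr heq (heq Set.self_mem_Ici)
    have h2 := (uniqueDiffWithinAt_Ici (0 : ℝ)).eq_deriv _ h1 (hαu m).2
    have h3 : (m : ℝ) = n := by linarith
    exact_mod_cast h3
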